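/- **Theorem (LBGI lower bound).** There is a universal constant $c>0$ with the following property. *Setting.* Let $N\ge 2$, $K\ge 1$, and let $w\in\mathbb{R}^D$ be a weight vector with nonnegative entries, not all zero. An environment $\mathcal V$ has $N$ groups of $K$ arms each; pulling arm $(i,j)$ returns an independent sample of a random vector in $\mathbb{R}^D$ with mean $\mu_{i,j}\in\mathbb{R}^D$, all of whose components are $1$-sub-Gaussian around their means; $\mu=(\mu_{i,j}^d)\in\mathbb{R}^{N\times K\times D}$ is its arm means tensor. Put $R_i^d=\max_{j}\mu_{i,j}^d$; the value of group $i$ is $R_i^\top w$, and $i^*=i^*(\mu)$ denotes the group of largest value when that group is unique. For a real number $\alpha$ and a vector $v$, $v+\alpha$ means that $\alpha$ is added to every component. For $i\ne i^*$ let $$\Delta_i=\inf\{\alpha>0 : (R_i+\alpha)^\top w>R_{i^*}^\top w\},\qquad \Delta_{i^*}=\min_{i\neq i^*}\Delta_i ,$$ and for every arm let $\Delta_{i,j}=\max(\alpha_{i,j},\Delta_i)$, where $$\alpha_{i,j}=\inf\{\alpha>0 : R(i,j,\alpha)^\top w>R_{i^*}^\top w\}$$ and $R(i,j,\alpha)$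 is the efficiency vector $R_i$ of group $i$ after $\mu_{i,j}$ has been replaced by $\mu_{i,j}+\alpha$. An algorithm consists of a (possibly randomized) sampling rule that chooses the next arm from the past observations, a stopping rule $\tau$ based on the observations so far, and a recommended group $\hat i_\tau$ that is a function of the observations up to time $\tau$. It is $\delta$-correct if in every environment whose arm means tensor $\mu\in\mathbb{R}^{N\times K\times D}$ has a unique best group, $\mathbb{P}\big(\tau<\infty,\ R_{\hat i_\tau}^\top w<R_{i^*(\mu)}^\top w\big)\le\delta$. Let $N_{i,j}(\tau)$ be the number of samples taken from arm $(i,j)$ before stopping. *Claim.* For every $\delta\in(0,1)$ and every tensor $\mu\in\mathbb{R}^{N\times K\times D}$ with a unique best group $i^*$, there is an environment $\mathcal V$ with arm means tensor $\mu$ in which every component of every arm's reward is Gaussian with variance $1$ and all arms are fully dependent (the reward $X$ of arm $(i,j)$ satisfies $X^d=X^1+(\mu_{i,j}^d-\mu_{i,j}^1)$ almost surely for all $d$), such that every $\delta$-correct algorithm whose stopping time is almost surely finite in $\mathcal V$ satisfies $$\mathbb{E}_{\mathcal V}[N_{i,j}(\tau)]\ \ge\ \frac{c}{\Delta_{i,j}^2}\log\Big(\frac1{2.4\,\delta}\Big)\quad\text{for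 every arm }(i,j)\text{ with }i\ne i^*,$$ $$\sum_{j=1}^K\mathbb{E}_{\mathcal V}[N_{i^*,j}(\tau)]\ \ge\ \frac{c}{\Delta_{i^*}^2}\log\Big(\frac1{2.4\,\delta}\Big).$$ -/

import Mathlib

open MeasureTheory ProbabilityTheory
open scoped ENNReal

noncomputable section

namespace LBGI

/-- Arms are pairs (group, arm inside the group). -/
abbrev Arm (N K : ℕ) := Fin N × Fin K

/-- One round of interaction: the pulled arm and the observed reward vector. -/
abbrev Step (N K D : ℕ) := Arm N K × (Fin D → ℝ)

/-- The observations made in the first `n` rounds. -/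
abbrev History (N K D n : ℕ) := Fin n → Step N K D

/-- Arm means tensors. -/
abbrev MeanTensor (N K D : ℕ) := Fin N → Fin K → Fin D → ℝ

/-! ### Environments -/

/-- A multi-objective multi-bandit environment: every arm has a reward distribution on `ℝ^D`
all of whose components are `1`-sub-Gaussian around their means. -/
structure Environment (N K D : ℕ) where
  /-- the reward distribution of an arm -/
  law : Arm N K → Measure (Fin D → ℝ)
  isProb : ∀ a, IsProbabilityMeasure (law a)
  integrable : ∀ a d, Integrable (fun x : Fin D → ℝ => x d) (law a)
  subGaussian : ∀ a d,
    HasSubgaussianMGF (fun x : Fin D → ℝ => x d - ∫ y, y d ∂(law a)) 1 (law a)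

namespace Environment

variable {N K D : ℕ}

instance (V : Environment N K D) (a : Arm N K) : IsProbabilityMeasure (V.law a) := V.isProb a

/-- The arm means tensor of an environment. -/
def mean (V : Environment N K D) : MeanTensor N K D :=
  fun i j d => ∫ x, x d ∂(V.law (i, j))

/-- Every reward component of every arm is Gaussian with variance `1`. -/
def IsUnitGaussian (V : Environment N K D) : Prop :=
  ∀ i j d, (V.law (i, j)).map (fun x => x d) = gaussianReal (V.mean i j d) 1

/-- All arms are fully dependent: any component of the reward vector determines the others,
the components differing almost surely by the (deterministic) differences of their means. -/
def IsFullyDependent (V : Environment N K D) : Prop :=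
  ∀ i j, ∀ᵐ x ∂(V.law (i, j)), ∀ d e : Fin D, x d = x e + (V.mean i j d - V.mean i j e)

/-- The reward distributions as a kernel from arms to reward vectors. -/
def rewardKernel (V : Environment N K D) : Kernel (Arm N K) (Fin D → ℝ) where
  toFun := V.law
  measurable' := measurable_of_countable _

instance (V : Environment N K D) : IsMarkovKernel V.rewardKernel := ⟨fun a => V.isProb a⟩

end Environment

/-! ### The linear best group identification problem -/

section Problem

variable {N K D : ℕ}

/-- The efficiency vector of a group: the componentwise maximum over its arms. -/
def efficiency (μ : MeanTensor N K D) (i : Fin N) (d : Fin D) : ℝ := ⨆ j : Fin K, μ i j d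

/-- The weighted reward of a vector. -/
def weighted (w v : Fin D → ℝ) : ℝ := ∑ d, v d * w d

/-- The weighted expected reward of a group. -/
def value (w : Fin D → ℝ) (μ : MeanTensor N K D) (i : Fin N) : ℝ :=
  weighted w (efficiency μ i)

/-- `i` is the unique best group. -/
def IsUniqueBest (w : Fin D → ℝ) (μ : MeanTensor N K D) (i : Fin N) : Prop :=
  ∀ k, k ≠ i → value w μ k < value w μ i

/-- The mean tensor in which `α` is added to all reward means of the arm `(i, j)`. -/
def raise (μ : MeanTensor N K D) (i : Fin N) (j : Fin K) (α : ℝ) : MeanTensor N K D :=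
  fun i' j' d => if i' = i ∧ j' = j then μ i' j' d + α else μ i' j' d

/-- The gap of a group `i` different from the best group `b`. -/
def subGap (w : Fin D → ℝ) (μ : MeanTensor N K D) (b i : Fin N) : ℝ :=
  sInf {α : ℝ | 0 < α ∧ value w μ b < weighted w (fun d => efficiency μ i d + α)}

/-- The gap `Δ_i` of a group when `b` is the best group; the best group itself gets the
smallest gap of the other groups. -/
def groupGap (w : Fin D → ℝ) (μ : MeanTensor N K D) (b i : Fin N) : ℝ :=
  if i = b then ⨅ k : {k : Fin N // k ≠ b}, subGap w μ b k else subGap w μ b i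

/-- The quantity `α_{i,j}`: how much has to be added to the means of the arm `(i, j)` so that
its group gets a higher weighted reward than the best group `b` of `μ`. -/
def armShift (w : Fin D → ℝ) (μ : MeanTensor N K D) (b i : Fin N) (j : Fin K) : ℝ :=
  sInf {α : ℝ | 0 < α ∧ value w μ b < value w (raise μ i j α) i}

/-- The gap `Δ_{i,j}` of an arm. -/
def armGap (w : Fin D → ℝ) (μ : MeanTensor N K D) (b i : Fin N) (j : Fin K) : ℝ :=
  max (armShift w μ b i j) (groupGap w μ b i)

end Problem

/-! ### Algorithms -/

/-- A sequential algorithm: a (possibly randomized) sampling rule, a stopping rule and a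
recommendation rule, all based on the observations made so far. -/
structure Algorithm (N K D : ℕ) where
  /-- the distribution of the next arm, given the history -/
  sample : (n : ℕ) → Kernel (History N K D n) (Arm N K)
  isMarkov : ∀ n, IsMarkovKernel (sample n)
  /-- the histories of length `n` after which the algorithm stops -/
  halt : (n : ℕ) → Set (History N K D n)
  measurableSet_halt : ∀ n, MeasurableSet (halt n)
  /-- the group recommended when the algorithm stops with the given history -/
  recommend : (n : ℕ) → History N K D n → Fin N
  measurable_recommend : ∀ n, Measurable (recommend n)

/-- The first `n` rounds of an infinite trajectory. -/
def prefixHistory {N K D : ℕ} (ω : ℕ → Step N K D) (n : ℕ) : History N K D n :=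
  fun i => ω i

/-- The rounds `0, …, n` seen as a history of length `n + 1`. -/
def toHistory {N K D : ℕ} (n : ℕ) (h : Finset.Iic n → Step N K D) : History N K D (n + 1) :=
  fun i => h ⟨i, Finset.mem_Iic.2 (Nat.lt_succ_iff.1 i.2)⟩

lemma measurable_toHistory {N K D : ℕ} (n : ℕ) :
    Measurable (toHistory n : _ → History N K D (n + 1)) :=
  measurable_pi_lambda _ fun _ => measurable_pi_apply _

namespace Algorithm

variable {N K D : ℕ}

instance (A : Algorithm N K D) (n : ℕ) : IsMarkovKernel (A.sample n) := A.isMarkov n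

/-- The conditional distribution of the next round given a history of length `n`: the arm is
drawn from the sampling rule and the reward from the distribution of that arm. -/
def stepKernel (A : Algorithm N K D) (V : Environment N K D) (n : ℕ) :
    Kernel (History N K D n) (Step N K D) :=
  (A.sample n) ⊗ₖ (V.rewardKernel.comap Prod.snd measurable_snd)

instance (A : Algorithm N K D) (V : Environment N K D) (n : ℕ) :
    IsMarkovKernel (A.stepKernel V n) := by
  unfold stepKernel; infer_instance

/-- The law of the infinite trajectory of the sampling rule in the environment `V` (the rounds
after the stopping time are irrelevant for everything below). -/
def trajectoryLaw (A : Algorithm N K D) (V : Environment N K D) : Measure (ℕ → Step N K D) :=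
  Kernel.trajMeasure (X := fun _ => Step N K D)
    (A.stepKernel V 0 Fin.elim0)
    (fun n => (A.stepKernel V (n + 1)).comap (toHistory n) (measurable_toHistory n))

/-- The stopping time: the number of rounds played, `⊤` if the algorithm never stops. -/
def tau (A : Algorithm N K D) (ω : ℕ → Step N K D) : ℕ∞ :=
  ⨅ (n : ℕ) (_ : prefixHistory ω n ∈ A.halt n), (n : ℕ∞)

/-- The recommended group (only meaningful when the stopping time is finite). -/
def output (A : Algorithm N K D) (ω : ℕ → Step N K D) : Fin N :=
  A.recommend (A.tau ω).toNat (prefixHistory ω (A.tau ω).toNat)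

/-- The number of pulls of the arm `a` before the algorithm stops. -/
def pulls (A : Algorithm N K D) (a : Arm N K) (ω : ℕ → Step N K D) : ℝ≥0∞ :=
  open Classical in ∑' t : ℕ, if (t : ℕ∞) < A.tau ω ∧ (ω t).1 = a then 1 else 0

/-- The expected number of samples from the arm `a` in the environment `V`. -/
def expectedPulls (A : Algorithm N K D) (V : Environment N K D) (a : Arm N K) : ℝ≥0∞ :=
  ∫⁻ ω, A.pulls a ω ∂(A.trajectoryLaw V)

/-- The stopping time is almost surely finite in the environment `V`. -/
def StopsAlmostSurely (A : Algorithm N K D) (V : Environment N K D) : Prop :=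
  ∀ᵐ ω ∂(A.trajectoryLaw V), A.tau ω < ⊤

/-- The algorithm is `(ε, δ)`-PAC for the LBGI problem with weights `w`: in every environment
with a unique best group, the probability to stop with a group whose weighted reward is too
small, even after adding `ε` to its efficiency vector, is at most `δ`. -/
def IsPAC (A : Algorithm N K D) (w : Fin D → ℝ) (ε δ : ℝ) : Prop :=
  ∀ (V : Environment N K D) (b : Fin N), IsUniqueBest w V.mean b →
    A.trajectoryLaw V {ω | A.tau ω < ⊤ ∧
      weighted w (fun d => efficiency V.mean (A.output ω) d + ε) < value w V.mean b}
      ≤ ENNReal.ofReal δ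

/-- `δ`-correct algorithms. -/
def IsDeltaCorrect (A : Algorithm N K D) (w : Fin D → ℝ) (δ : ℝ) : Prop :=
  A.IsPAC w 0 δ

end Algorithm

end LBGI

end

noncomputable section

namespace LBGI

/-! ### Fully dependent Gaussian environments -/

/-! In `gaussianEnv μ` all components of a reward share one standard Gaussian noise. Translating
every mean of an arm by `s` is therefore a one-dimensional shift: its likelihood ratio can be read
from any single component, and its price per pull, of order `s ^ 2`, does not grow with `D`.

The lower bound is a change of measure. Under `μ` the algorithm stops and recommends `b` with
probability at least `1 - δ`; under shifted means with another unique best group, with probability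
at most `δ`. On the part of this event where the stopped log-likelihood ratio is at least `-x`, the
`μ`-probability is at most `exp x * δ` (`measure_stopAt_inter_le`). The ratio is a martingale minus
half of the accumulated cost, and the second moment of the martingale is the expected cost
(`lintegral_sq_stoppedNoise`), so Markov and Chebyshev bound the rest by `B / x + 4 * B / x ^ 2`
when the expected cost is at most `B` (`measure_stoppedLLR_lt_le`). Taking `exp x = √((1 - δ) / δ)`
forces `B` to be of order `log (1 / δ)` (`log_le_of_transport`). This replaces the relative entropy
inequality at a stopping time, with a worse constant.

For an arm outside the best group, only that arm is raised, until its group wins. For the best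
group, all its arms are lowered below the runner-up, which is raised by an arbitrarily small amount
to break ties. The expected pulls of the runner-up may be infinite, so `log_le_sum_expectedPulls`
works at a finite horizon and chooses the small raise afterwards. -/

lemma integral_add_gaussianReal (c : ℝ) : ∫ z, (c + z) ∂(gaussianReal 0 1) = c := by
  rw [integral_add (integrable_const _)]
  · simp [integral_id_gaussianReal]
  · exact (memLp_id_gaussianReal (μ := 0) (v := 1) 1).integrable le_rfl

lemma measurable_const_add_pi {ι : Type*} (m : ι → ℝ) : Measurable fun (z : ℝ) d => m d + z :=
  measurable_pi_lambda _ fun _ => measurable_const_add _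

/-- The law of the constant vector with a standard Gaussian entry, translated by `m`. -/
def diagonalGaussian {D : ℕ} (m : Fin D → ℝ) : Measure (Fin D → ℝ) :=
  (gaussianReal 0 1).map fun z d => m d + z

instance {D : ℕ} (m : Fin D → ℝ) : IsProbabilityMeasure (diagonalGaussian m) :=
  Measure.isProbabilityMeasure_map (measurable_const_add_pi m).aemeasurable

lemma lintegral_diagonalGaussian {D : ℕ} (m : Fin D → ℝ) {φ : (Fin D → ℝ) → ℝ≥0∞}
    (hφ : Measurable φ) :
    ∫⁻ x, φ x ∂(diagonalGaussian m) = ∫⁻ z, φ (fun d => m d + z) ∂(gaussianReal 0 1) :=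
  lintegral_map hφ (measurable_const_add_pi m)

lemma integral_apply_diagonalGaussian {D : ℕ} (m : Fin D → ℝ) (d : Fin D) :
    ∫ x, x d ∂(diagonalGaussian m) = m d := by
  rw [diagonalGaussian, integral_map (measurable_const_add_pi m).aemeasurable
    (measurable_pi_apply d).aestronglyMeasurable]
  exact integral_add_gaussianReal _

lemma map_apply_diagonalGaussian {D : ℕ} (m : Fin D → ℝ) (d : Fin D) :
    (diagonalGaussian m).map (fun x => x d) = gaussianReal (m d) 1 := by
  rw [diagonalGaussian, Measure.map_map (measurable_pi_apply d) (measurable_const_add_pi m)]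
  have := gaussianReal_map_const_add (μ := 0) (v := 1) (m d)
  rw [zero_add] at this
  exact this

lemma map_apply_sub_diagonalGaussian {D : ℕ} (m : Fin D → ℝ) (d : Fin D) :
    (diagonalGaussian m).map (fun x => x d - m d) = gaussianReal 0 1 := by
  have h := gaussianReal_map_sub_const (μ := m d) (v := 1) (m d)
  have hm : Measurable fun x : ℝ => x - m d := measurable_id.sub_const _
  rw [← map_apply_diagonalGaussian m d, Measure.map_map hm (measurable_pi_apply d), sub_self] at h
  exact h

/-- The environment with arm means tensor `μ` in which all components of a reward have the same
standard Gaussian noise. -/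
def gaussianEnv {N K D : ℕ} (μ : MeanTensor N K D) : Environment N K D where
  law a := diagonalGaussian (μ a.1 a.2)
  isProb _ := inferInstance
  integrable a d := by
    refine (integrable_map_measure (g := id) ?_ (measurable_pi_apply d).aemeasurable).1 ?_
    · exact measurable_id.aestronglyMeasurable
    · rw [map_apply_diagonalGaussian]
      exact (memLp_id_gaussianReal 1).integrable le_rfl
  subGaussian a d := by
    simp only [integral_apply_diagonalGaussian]
    have h := map_apply_sub_diagonalGaussian (μ a.1 a.2) d
    have hm : Measurable fun x : Fin D → ℝ => x d - μ a.1 a.2 d :=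
      (measurable_pi_apply d).sub_const _
    refine ⟨fun t => ?_, fun t => ?_⟩
    · refine (integrable_map_measure (g := fun z => Real.exp (t * z)) ?_ hm.aemeasurable).1 ?_
      · exact (by fun_prop : Measurable fun z => Real.exp (t * z)).aestronglyMeasurable
      · rw [h]
        exact integrable_exp_mul_gaussianReal t
    · rw [mgf_gaussianReal h]
      simp

section

variable {N K D : ℕ}

@[simp]
lemma mean_gaussianEnv (μ : MeanTensor N K D) : (gaussianEnv μ).mean = μ := by
  funext i j d
  exact integral_apply_diagonalGaussian _ d

lemma isUnitGaussian_gaussianEnv (μ : MeanTensor N K D) : (gaussianEnv μ).IsUnitGaussian := by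
  intro i j d
  rw [mean_gaussianEnv]
  exact map_apply_diagonalGaussian _ d

lemma isFullyDependent_gaussianEnv (μ : MeanTensor N K D) :
    (gaussianEnv μ).IsFullyDependent := by
  intro i j
  rw [mean_gaussianEnv]
  have hs : MeasurableSet {x : Fin D → ℝ | ∀ d e : Fin D, x d = x e + (μ i j d - μ i j e)} := by
    simp only [Set.ofPred_forall]
    exact MeasurableSet.iInter fun d => MeasurableSet.iInter fun e =>
      measurableSet_eq_fun (measurable_pi_apply d) ((measurable_pi_apply e).add_const _)
  refine (ae_map_iff (measurable_const_add_pi _).aemeasurable hs).2 ?_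
  filter_upwards with z d e
  ring

/-- The log-likelihood ratio of a step when the means of the arm `a` are shifted by `s a`,
computed from the component `d`. -/
def stepLLR (μ : MeanTensor N K D) (s : Arm N K → ℝ) (d : Fin D) (p : Step N K D) : ℝ :=
  s p.1 * (p.2 d - μ p.1.1 p.1.2 d) - s p.1 ^ 2 / 2

/-- The tensor `μ` with all means of the arm `a` shifted by `s a`. -/
def shiftMean (μ : MeanTensor N K D) (s : Arm N K → ℝ) : MeanTensor N K D :=
  fun i j d => μ i j d + s (i, j)

/-- One-dimensional Cameron–Martin formula: the quotient of the two Gaussian densities is `exp (s *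
z - s ^ 2 / 2)`. -/
lemma lintegral_gaussianReal_comp_const_add {φ : ℝ → ℝ≥0∞} (hφ : Measurable φ) (s : ℝ) :
    ∫⁻ z, φ (s + z) ∂(gaussianReal 0 1)
      = ∫⁻ z, φ z * ENNReal.ofReal (Real.exp (s * z - s ^ 2 / 2)) ∂(gaussianReal 0 1) := by
  rw [← lintegral_map hφ (measurable_const_add s), gaussianReal_map_const_add,
    gaussianReal_of_var_ne_zero _ one_ne_zero, gaussianReal_of_var_ne_zero _ one_ne_zero,
    lintegral_withDensity_eq_lintegral_mul _ (measurable_gaussianPDF _ _) hφ,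
    lintegral_withDensity_eq_lintegral_mul _ (measurable_gaussianPDF _ _) (by fun_prop)]
  refine lintegral_congr fun z => ?_
  simp only [Pi.mul_apply]
  rw [mul_comm (φ z), ← mul_assoc]
  congr 1
  rw [gaussianPDF, gaussianPDF, ← ENNReal.ofReal_mul (gaussianPDFReal_nonneg _ _ _),
    gaussianPDFReal, gaussianPDFReal, mul_assoc _ (Real.exp _) (Real.exp _), ← Real.exp_add]
  congr 3
  simp only [NNReal.coe_one]
  ring

lemma lintegral_law_shiftMean (μ : MeanTensor N K D) (s : Arm N K → ℝ) (d : Fin D) (a : Arm N K)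
    {φ : (Fin D → ℝ) → ℝ≥0∞} (hφ : Measurable φ) :
    ∫⁻ x, φ x ∂((gaussianEnv (shiftMean μ s)).law a)
      = ∫⁻ x, φ x * ENNReal.ofReal (Real.exp (stepLLR μ s d (a, x))) ∂((gaussianEnv μ).law a) := by
  have hm : Measurable fun x : Fin D → ℝ => stepLLR μ s d (a, x) := by
    unfold stepLLR; fun_prop
  simp only [gaussianEnv]
  rw [lintegral_diagonalGaussian _ hφ, lintegral_diagonalGaussian _ (by fun_prop)]
  have h := lintegral_gaussianReal_comp_const_add (φ := fun z => φ fun d => μ a.1 a.2 d + z)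
    (hφ.comp (measurable_const_add_pi _)) (s a)
  simpa [shiftMean, stepLLR, add_assoc] using h

lemma lintegral_gaussianReal_sq (m s : ℝ) :
    ∫⁻ z, ENNReal.ofReal ((m + s * z) ^ 2) ∂(gaussianReal 0 1) = ENNReal.ofReal (m ^ 2 + s ^ 2) := by
  have h2 : MemLp id 2 (gaussianReal 0 1) := memLp_id_gaussianReal' 2 (by simp)
  have hi : Integrable (fun z : ℝ => z) (gaussianReal 0 1) :=
    (memLp_id_gaussianReal (μ := 0) (v := 1) 1).integrable le_rfl
  have hi2 : Integrable (fun z : ℝ => z ^ 2) (gaussianReal 0 1) := h2.integrable_sq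
  have hv : ∫ z, z ^ 2 ∂(gaussianReal 0 1) = 1 := by
    have h := variance_fun_id_gaussianReal (μ := 0) (v := 1)
    rw [variance_of_integral_eq_zero (by fun_prop) integral_id_gaussianReal] at h
    simpa using h
  have he : (fun z : ℝ => (m + s * z) ^ 2) = fun z => (m ^ 2 + 2 * m * s * z) + s ^ 2 * z ^ 2 := by
    funext z; ring
  have hI1 : Integrable (fun z : ℝ => m ^ 2 + 2 * m * s * z) (gaussianReal 0 1) :=
    (integrable_const _).add (hi.const_mul _)
  rw [← ofReal_integral_eq_lintegral_ofReal _ (ae_of_all _ fun z => sq_nonneg _)]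
  · rw [he, integral_add hI1 (hi2.const_mul _), integral_add (integrable_const _) (hi.const_mul _),
      integral_const_mul, integral_const_mul, hv, integral_id_gaussianReal]
    simp
  · rw [he]
    exact hI1.add (hi2.const_mul _)

lemma lintegral_law_sq (μ : MeanTensor N K D) (d : Fin D) (a : Arm N K) (m s : ℝ) :
    ∫⁻ x, ENNReal.ofReal ((m + s * (x d - μ a.1 a.2 d)) ^ 2) ∂((gaussianEnv μ).law a)
      = ENNReal.ofReal (m ^ 2 + s ^ 2) := by
  simp only [gaussianEnv]
  rw [lintegral_diagonalGaussian _ (by fun_prop), ← lintegral_gaussianReal_sq]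
  simp

end

variable {N K D : ℕ}

/-! ### One step of the trajectory -/

lemma measurable_prefixHistory (n : ℕ) :
    Measurable fun ω : ℕ → Step N K D => prefixHistory ω n :=
  measurable_pi_lambda _ fun _ => measurable_pi_apply _

/-- A function of trajectories that only depends on the first `n` rounds. -/
def DependsOnPrefix {β : Type*} (n : ℕ) (f : (ℕ → Step N K D) → β) : Prop :=
  ∀ ω ω' : ℕ → Step N K D, (∀ t < n, ω t = ω' t) → f ω = f ω'

lemma dependsOnPrefix_prefixHistory (n : ℕ) :
    DependsOnPrefix n fun ω : ℕ → Step N K D => prefixHistory ω n :=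
  fun _ _ h => funext fun i => h i i.2

lemma DependsOnPrefix.mono {β : Type*} {m n : ℕ} (hmn : m ≤ n) {f : (ℕ → Step N K D) → β}
    (hf : DependsOnPrefix m f) : DependsOnPrefix n f :=
  fun ω ω' h => hf ω ω' fun t ht => h t (ht.trans_le hmn)

namespace Algorithm

variable (A : Algorithm N K D) (V : Environment N K D)

instance : IsProbabilityMeasure (A.trajectoryLaw V) := by
  unfold trajectoryLaw; infer_instance

lemma map_apply_zero_trajectoryLaw :
    (A.trajectoryLaw V).map (fun ω => ω 0) = A.stepKernel V 0 Fin.elim0 := by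
  let κ : (n : ℕ) → Kernel (Finset.Iic n → Step N K D) (Step N K D) :=
    fun n => (A.stepKernel V (n + 1)).comap (toHistory n) (measurable_toHistory n)
  let e : ((i : Finset.Iic 0) → Step N K D) ≃ᵐ Step N K D :=
    MeasurableEquiv.piUnique (fun _ : Finset.Iic 0 => Step N K D)
  have h : (A.trajectoryLaw V).map (Preorder.frestrictLe (π := fun _ => Step N K D) 0)
      = (A.stepKernel V 0 Fin.elim0).map e.symm := by
    unfold trajectoryLaw Kernel.trajMeasure
    rw [Measure.map_comp _ _ (by fun_prop), Kernel.traj_map_frestrictLe, Kernel.partialTraj_self,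
      Measure.id_comp]
  have h2 : (fun ω : ℕ → Step N K D => ω 0)
      = e ∘ Preorder.frestrictLe (π := fun _ => Step N K D) 0 := rfl
  rw [h2, ← Measure.map_map e.measurable (by fun_prop), h,
    Measure.map_map e.measurable e.symm.measurable]
  simp

/-- The defining property of the trajectory law: given the first `n` rounds, round `n` has law
`stepKernel`. Later computations use the trajectory law through this identity. -/
lemma lintegral_next (n : ℕ) {Φ : (ℕ → Step N K D) → Step N K D → ℝ≥0∞}
    (hΦ : Measurable (Function.uncurry Φ)) (hd : DependsOnPrefix n Φ) :
    ∫⁻ ω, Φ ω (ω n) ∂(A.trajectoryLaw V)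
      = ∫⁻ ω, ∫⁻ p, Φ ω p ∂(A.stepKernel V n (prefixHistory ω n)) ∂(A.trajectoryLaw V) := by
  obtain ⟨ω₀⟩ : Nonempty (ℕ → Step N K D) := (A.trajectoryLaw V).nonempty_of_neZero
  rcases n with _ | n
  -- Round 0 is separate because `trajMeasure` starts from a measure, not from a kernel on empty
  -- histories.
  · have hΦ0 : ∀ ω, Φ ω = Φ ω₀ := fun ω => hd _ _ fun t ht => absurd ht (Nat.not_lt_zero t)
    have hp : ∀ ω : ℕ → Step N K D, prefixHistory ω 0 = Fin.elim0 :=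
      fun ω => funext fun i => i.elim0
    have hm : Measurable (Φ ω₀) := hΦ.comp measurable_prodMk_left
    simp only [hΦ0, hp, lintegral_const, measure_univ, mul_one]
    rw [← map_apply_zero_trajectoryLaw, lintegral_map hm (measurable_pi_apply 0)]
  -- A finite history is continued by a fixed trajectory `ω₀`, so that `Φ` can be evaluated on it;
  -- the continuation is irrelevant by `hd`.
  · let padded : (Finset.Iic n → Step N K D) → ℕ → Step N K D :=
      fun h t => if ht : t ∈ Finset.Iic n then h ⟨t, ht⟩ else ω₀ t
    have hext : Measurable padded := by
      refine measurable_pi_lambda _ fun t => ?_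
      by_cases ht : t ∈ Finset.Iic n
      · simpa only [padded, ht, dite_true] using measurable_pi_apply _
      · simpa only [padded, ht, dite_false] using measurable_const
    have hΦe : ∀ ω, Φ ω = Φ (padded (Preorder.frestrictLe (π := fun _ => Step N K D) n ω)) := by
      refine fun ω => hd _ _ fun t ht => ?_
      have : t ∈ Finset.Iic n := Finset.mem_Iic.2 (Nat.lt_succ_iff.1 ht)
      simp [padded, Nat.lt_succ_iff.1 ht]
    have hm : Measurable fun q : (Finset.Iic n → Step N K D) × Step N K D =>
        Φ (padded q.1) q.2 :=
      hΦ.comp ((hext.comp measurable_fst).prodMk measurable_snd)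
    have key := Kernel.map_frestrictLe_trajMeasure_compProd_eq_map_trajMeasure
      (X := fun _ => Step N K D) (μ₀ := A.stepKernel V 0 Fin.elim0)
      (κ := fun n => (A.stepKernel V (n + 1)).comap (toHistory n) (measurable_toHistory n))
      (a := n)
    have h1 := congrArg (fun m => ∫⁻ q, Φ (padded q.1) q.2 ∂m) key
    rw [Measure.lintegral_compProd hm, lintegral_map hm (by fun_prop),
      lintegral_map (hm.lintegral_kernel_prod_right') (by fun_prop)] at h1
    have h2 : ∀ ω, Φ ω (ω (n + 1))
        = Φ (padded (Preorder.frestrictLe (π := fun _ => Step N K D) n ω)) (ω (n + 1)) :=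
      fun ω => congrFun (hΦe ω) _
    have h3 : ∀ ω, ∫⁻ p, Φ ω p ∂(A.stepKernel V (n + 1) (prefixHistory ω (n + 1)))
        = ∫⁻ p, Φ (padded (Preorder.frestrictLe (π := fun _ => Step N K D) n ω)) p
          ∂(A.stepKernel V (n + 1) (prefixHistory ω (n + 1))) :=
      fun ω => by rw [← hΦe ω]
    rw [lintegral_congr h2, lintegral_congr h3]
    exact h1.symm

lemma lintegral_stepKernel (n : ℕ) (h : History N K D n) {φ : Step N K D → ℝ≥0∞}
    (hφ : Measurable φ) :
    ∫⁻ p, φ p ∂(A.stepKernel V n h) = ∫⁻ a, ∫⁻ x, φ (a, x) ∂(V.law a) ∂(A.sample n h) := by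
  unfold stepKernel
  rw [Kernel.lintegral_compProd _ _ _ hφ]
  rfl

lemma lintegral_next_congr (n : ℕ) {Φ Ψ : (ℕ → Step N K D) → Step N K D → ℝ≥0∞}
    (hΦ : Measurable (Function.uncurry Φ)) (hdΦ : DependsOnPrefix n Φ)
    (hΨ : Measurable (Function.uncurry Ψ)) (hdΨ : DependsOnPrefix n Ψ)
    (h : ∀ ω a, ∫⁻ x, Φ ω (a, x) ∂(V.law a) = ∫⁻ x, Ψ ω (a, x) ∂(V.law a)) :
    ∫⁻ ω, Φ ω (ω n) ∂(A.trajectoryLaw V) = ∫⁻ ω, Ψ ω (ω n) ∂(A.trajectoryLaw V) := by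
  rw [lintegral_next A V n hΦ hdΦ, lintegral_next A V n hΨ hdΨ]
  refine lintegral_congr fun ω => ?_
  rw [lintegral_stepKernel _ _ _ _ hΦ.of_uncurry_left,
    lintegral_stepKernel _ _ _ _ hΨ.of_uncurry_left]
  exact lintegral_congr fun a => h ω a

end Algorithm

/-! ### Change of measure -/

lemma measurable_stepLLR (μ : MeanTensor N K D) (s : Arm N K → ℝ) (d : Fin D) :
    Measurable (stepLLR μ s d) := by
  have h1 : Measurable s := measurable_of_countable _
  have h2 : Measurable fun a : Arm N K => μ a.1 a.2 d := measurable_of_countable _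
  exact ((h1.comp measurable_fst).mul (((measurable_pi_apply d).comp measurable_snd).sub
    (h2.comp measurable_fst))).sub (((h1.comp measurable_fst).pow_const 2).div_const 2)

/-- The sampling rule is the same kernel in both environments, so its contribution cancels and only
the reward densities of the rounds played remain. -/
lemma lintegral_trajectoryLaw_shiftMean (A : Algorithm N K D) (μ : MeanTensor N K D)
    (s : Arm N K → ℝ) (d : Fin D) (n : ℕ) {Φ : (ℕ → Step N K D) → ℝ≥0∞} (hΦ : Measurable Φ)
    (hd : DependsOnPrefix n Φ) :
    ∫⁻ ω, Φ ω ∂(A.trajectoryLaw (gaussianEnv (shiftMean μ s)))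
      = ∫⁻ ω, Φ ω * ENNReal.ofReal (Real.exp (∑ t ∈ Finset.range n, stepLLR μ s d (ω t)))
          ∂(A.trajectoryLaw (gaussianEnv μ)) := by
  have hℓ := measurable_stepLLR μ s d
  have hS : ∀ n, Measurable fun ω : ℕ → Step N K D =>
      ENNReal.ofReal (Real.exp (∑ t ∈ Finset.range n, stepLLR μ s d (ω t))) := fun n =>
    (Real.measurable_exp.comp (Finset.measurable_sum _ fun t _ =>
      hℓ.comp (measurable_pi_apply t))).ennreal_ofReal
  have hf : Measurable fun p : Step N K D => ENNReal.ofReal (Real.exp (stepLLR μ s d p)) :=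
    (Real.measurable_exp.comp hℓ).ennreal_ofReal
  induction n generalizing Φ with
  | zero =>
    obtain ⟨ω₀⟩ : Nonempty (ℕ → Step N K D) :=
      (A.trajectoryLaw (gaussianEnv μ)).nonempty_of_neZero
    have hΦ0 : ∀ ω, Φ ω = Φ ω₀ := fun ω => hd _ _ fun t ht => absurd ht (Nat.not_lt_zero t)
    simp [hΦ0]
  | succ n ih =>
    have hup : Measurable fun q : (ℕ → Step N K D) × Step N K D => Function.update q.1 n q.2 := by
      refine measurable_pi_lambda _ fun t => ?_
      by_cases ht : t = n
      · subst ht; simpa using measurable_snd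
      · simp only [Function.update_of_ne ht]
        exact (measurable_pi_apply t).comp measurable_fst
    let Ψ : (ℕ → Step N K D) → Step N K D → ℝ≥0∞ := fun ω p => Φ (Function.update ω n p)
    have hΨ : Measurable (Function.uncurry Ψ) := hΦ.comp hup
    have hdΨ : DependsOnPrefix n Ψ := by
      refine fun ω ω' h => funext fun p => hd _ _ fun t ht => ?_
      rcases (Nat.lt_succ_iff.1 ht).lt_or_eq with h' | rfl
      · simp [Function.update_of_ne h'.ne, h t h']
      · simp
    have hΨΦ : ∀ ω, Ψ ω (ω n) = Φ ω := fun ω => by simp [Ψ]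
    let G : (ℕ → Step N K D) → Step N K D → ℝ≥0∞ :=
      fun ω p => Ψ ω p * ENNReal.ofReal (Real.exp (stepLLR μ s d p))
    have hG : Measurable (Function.uncurry G) := hΨ.mul (hf.comp measurable_snd)
    have hdG : DependsOnPrefix n G := fun ω ω' h => by simp only [G, hdΨ ω ω' h]
    -- `I` integrates out round `n` under `μ` with its likelihood factor included. It depends on the
    -- first `n` rounds only, so the induction hypothesis applies to it.
    let I : (ℕ → Step N K D) → ℝ≥0∞ :=
      fun ω => ∫⁻ p, G ω p ∂(A.stepKernel (gaussianEnv μ) n (prefixHistory ω n))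
    have hI : Measurable I :=
      hG.lintegral_kernel_prod_right' (κ := (A.stepKernel (gaussianEnv μ) n).comap
        (fun ω => prefixHistory ω n) (measurable_prefixHistory n))
    have hdI : DependsOnPrefix n I := fun ω ω' h => by
      simp only [I, hdG ω ω' h, dependsOnPrefix_prefixHistory n ω ω' h]
    have hleft : ∫⁻ ω, Φ ω ∂(A.trajectoryLaw (gaussianEnv (shiftMean μ s)))
        = ∫⁻ ω, I ω ∂(A.trajectoryLaw (gaussianEnv (shiftMean μ s))) := by
      simp only [← hΨΦ]
      rw [A.lintegral_next _ n hΨ hdΨ]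
      refine lintegral_congr fun ω => ?_
      rw [A.lintegral_stepKernel _ _ _ hΨ.of_uncurry_left]
      simp only [I]
      rw [A.lintegral_stepKernel _ _ _ hG.of_uncurry_left]
      exact lintegral_congr fun a => lintegral_law_shiftMean μ s d a
        (hΨ.of_uncurry_left.comp measurable_prodMk_left)
    rw [hleft, ih hI hdI]
    let H : (ℕ → Step N K D) → Step N K D → ℝ≥0∞ := fun ω p =>
      G ω p * ENNReal.ofReal (Real.exp (∑ t ∈ Finset.range n, stepLLR μ s d (ω t)))
    have hH : Measurable (Function.uncurry H) := hG.mul ((hS n).comp measurable_fst)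
    have hdH : DependsOnPrefix n H := fun ω ω' h => by
      have : ∑ t ∈ Finset.range n, stepLLR μ s d (ω t)
          = ∑ t ∈ Finset.range n, stepLLR μ s d (ω' t) :=
        Finset.sum_congr rfl fun t ht => by rw [h t (Finset.mem_range.1 ht)]
      simp only [H, hdG ω ω' h, this]
    have hright := A.lintegral_next (gaussianEnv μ) n hH hdH
    have hIH : ∀ ω, ∫⁻ p, H ω p ∂(A.stepKernel (gaussianEnv μ) n (prefixHistory ω n))
        = I ω * ENNReal.ofReal (Real.exp (∑ t ∈ Finset.range n, stepLLR μ s d (ω t))) :=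
      fun ω => lintegral_mul_const _ hG.of_uncurry_left
    rw [lintegral_congr hIH] at hright
    rw [← hright]
    refine lintegral_congr fun ω => ?_
    simp only [H, G, hΨΦ]
    rw [Finset.sum_range_succ, Real.exp_add, ENNReal.ofReal_mul (Real.exp_pos _).le, mul_assoc,
      mul_comm (ENNReal.ofReal (Real.exp (stepLLR μ s d (ω n))))]

lemma DependsOnPrefix.indicator_one {β : Type*} [Zero β] [One β] {n : ℕ}
    {S : Set (ℕ → Step N K D)} (hS : DependsOnPrefix n fun ω => ω ∈ S) :
    DependsOnPrefix n (S.indicator (1 : (ℕ → Step N K D) → β)) := by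
  intro ω ω' h
  have h' : ω ∈ S ↔ ω' ∈ S := iff_of_eq (hS ω ω' h)
  by_cases hω : ω ∈ S
  · rw [Set.indicator_of_mem hω, Set.indicator_of_mem (h'.1 hω)]; rfl
  · rw [Set.indicator_of_notMem hω, Set.indicator_of_notMem fun hc => hω (h'.2 hc)]

/-! ### The stopping time -/

namespace Algorithm

variable (A : Algorithm N K D)

/-- The trajectories along which the algorithm has not stopped after `t` rounds. -/
def running (t : ℕ) : Set (ℕ → Step N K D) := {ω | (t : ℕ∞) < A.tau ω}

lemma mem_running_iff (t : ℕ) (ω : ℕ → Step N K D) :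
    ω ∈ A.running t ↔ ∀ k ≤ t, prefixHistory ω k ∉ A.halt k := by
  refine ⟨fun h k hk hm => ?_, fun h => ?_⟩
  · have h1 : A.tau ω ≤ k := iInf₂_le k hm
    have h2 : (k : ℕ∞) ≤ t := by exact_mod_cast hk
    exact absurd (h1.trans h2) (not_le.2 h)
  · have h1 : ((t + 1 : ℕ) : ℕ∞) ≤ A.tau ω := by
      refine le_iInf₂ fun n hn => ?_
      have : t < n := by
        by_contra hc
        exact h n (not_lt.1 hc) hn
      exact_mod_cast this
    exact lt_of_lt_of_le (by exact_mod_cast Nat.lt_succ_self t) h1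

lemma measurableSet_running (t : ℕ) : MeasurableSet (A.running t) := by
  have : A.running t = ⋂ k : ℕ, ⋂ _ : k ≤ t, (fun ω => prefixHistory ω k) ⁻¹' (A.halt k)ᶜ := by
    ext ω
    simp [mem_running_iff]
  rw [this]
  exact MeasurableSet.iInter fun k => MeasurableSet.iInter fun _ =>
    measurable_prefixHistory k (A.measurableSet_halt k).compl

/-- Rounds are counted from 0, so whether round `t` is played is decided before it is observed. This
predictability makes the stopped noise a martingale. -/
lemma dependsOnPrefix_running (t : ℕ) : DependsOnPrefix t fun ω => ω ∈ A.running t := by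
  intro ω ω' h
  simp only [mem_running_iff]
  refine propext (forall₂_congr fun k hk => ?_)
  have he : prefixHistory ω k = prefixHistory ω' k :=
    (dependsOnPrefix_prefixHistory k).mono hk ω ω' h
  rw [he]

/-- The indicator of the event that round `t` is played before stopping. -/
def active (t : ℕ) : (ℕ → Step N K D) → ℝ := (A.running t).indicator 1

lemma measurable_active (t : ℕ) : Measurable (A.active t) :=
  measurable_one.indicator (A.measurableSet_running t)

lemma dependsOnPrefix_active (t : ℕ) : DependsOnPrefix t (A.active t) :=
  (A.dependsOnPrefix_running t).indicator_one

lemma active_of_lt {t : ℕ} {ω : ℕ → Step N K D} (h : (t : ℕ∞) < A.tau ω) : A.active t ω = 1 :=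
  Set.indicator_of_mem (s := A.running t) h _

lemma active_of_not_lt {t : ℕ} {ω : ℕ → Step N K D} (h : ¬ (t : ℕ∞) < A.tau ω) :
    A.active t ω = 0 :=
  Set.indicator_of_notMem (s := A.running t) h _

lemma active_sq (t : ℕ) (ω : ℕ → Step N K D) : A.active t ω ^ 2 = A.active t ω := by
  by_cases h : (t : ℕ∞) < A.tau ω
  · simp [A.active_of_lt h]
  · simp [A.active_of_not_lt h]

lemma active_nonneg (t : ℕ) (ω : ℕ → Step N K D) : 0 ≤ A.active t ω := by
  rw [← active_sq]; positivity

lemma active_le_one (t : ℕ) (ω : ℕ → Step N K D) : A.active t ω ≤ 1 := by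
  by_cases h : (t : ℕ∞) < A.tau ω
  · simp [A.active_of_lt h]
  · simp [A.active_of_not_lt h]

/-- The trajectories along which the algorithm stops after `m` rounds and recommends `b`. -/
def stopAt (b : Fin N) (m : ℕ) : Set (ℕ → Step N K D) := {ω | A.tau ω = m ∧ A.output ω = b}

lemma stopAt_eq (b : Fin N) (m : ℕ) :
    A.stopAt b m = ((⋂ k : Fin m, A.running k) ∩ (A.running m)ᶜ) ∩
      (fun ω => A.recommend m (prefixHistory ω m)) ⁻¹' {b} := by
  ext ω
  have h : A.tau ω = m ↔ (∀ k : Fin m, ((k : ℕ) : ℕ∞) < A.tau ω) ∧ ¬ (m : ℕ∞) < A.tau ω := by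
    refine ⟨fun h => ?_, fun h => le_antisymm (not_lt.1 h.2) (not_lt.1 fun hc => ?_)⟩
    · rw [h]
      exact ⟨fun k => by exact_mod_cast k.2, lt_irrefl _⟩
    · obtain ⟨k, hk⟩ := ENat.ne_top_iff_exists.1 (ne_top_of_lt hc)
      rw [← hk] at hc h
      exact lt_irrefl _ (h.1 ⟨k, by exact_mod_cast hc⟩)
  simp only [stopAt, running, Set.mem_inter_iff, Set.mem_iInter, Set.mem_compl_iff,
    Set.mem_preimage, Set.mem_singleton_iff, Set.mem_ofPred_eq, ← h]
  refine and_congr_right fun hm => ?_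
  have ht : (A.tau ω).toNat = m := by rw [hm, ENat.toNat_natCast]
  have ho : A.output ω = A.recommend m (prefixHistory ω m) := by
    rw [output, ht]
  rw [ho]

lemma measurableSet_stopAt (b : Fin N) (m : ℕ) : MeasurableSet (A.stopAt b m) := by
  rw [stopAt_eq]
  exact ((MeasurableSet.iInter fun k : Fin m => A.measurableSet_running k).inter
    (A.measurableSet_running m).compl).inter
    (((A.measurable_recommend m).comp (measurable_prefixHistory m)) (measurableSet_singleton b))

lemma dependsOnPrefix_stopAt (b : Fin N) (m : ℕ) :
    DependsOnPrefix m fun ω => ω ∈ A.stopAt b m := by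
  intro ω ω' h
  have h1 : ∀ k : Fin m, (ω ∈ A.running k) = (ω' ∈ A.running k) := fun k =>
    (A.dependsOnPrefix_running k).mono k.2.le ω ω' h
  have h2 := A.dependsOnPrefix_running m ω ω' h
  have h3 := dependsOnPrefix_prefixHistory m ω ω' h
  simp only at h2 h3
  simp only [stopAt_eq, Set.mem_inter_iff, Set.mem_iInter, Set.mem_compl_iff, Set.mem_preimage,
    h1, h2, h3]

lemma pairwise_disjoint_stopAt (b : Fin N) : Pairwise (Function.onFun Disjoint (A.stopAt b)) := by
  intro m n hmn
  refine Set.disjoint_left.2 fun ω hm hn => hmn ?_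
  exact_mod_cast hm.1.symm.trans hn.1

lemma iUnion_stopAt (b : Fin N) : ⋃ m, A.stopAt b m = {ω | A.tau ω < ⊤ ∧ A.output ω = b} := by
  ext ω
  simp only [stopAt, Set.mem_iUnion, Set.mem_ofPred_eq]
  constructor
  · rintro ⟨m, hm, ho⟩
    exact ⟨hm ▸ ENat.natCast_lt_top m, ho⟩
  · rintro ⟨ht, ho⟩
    obtain ⟨m, hm⟩ := ENat.ne_top_iff_exists.1 ht.ne
    exact ⟨m, hm.symm, ho⟩

/-! ### The stopped log-likelihood ratio -/

/-- The log-likelihood ratio of the first `n` rounds, frozen at the stopping time. -/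
def stoppedLLR (μ : MeanTensor N K D) (s : Arm N K → ℝ) (d : Fin D) (n : ℕ)
    (ω : ℕ → Step N K D) : ℝ :=
  ∑ t ∈ Finset.range n, A.active t ω * stepLLR μ s d (ω t)

/-- The martingale part of the stopped log-likelihood ratio. -/
def stoppedNoise (μ : MeanTensor N K D) (s : Arm N K → ℝ) (d : Fin D) (n : ℕ)
    (ω : ℕ → Step N K D) : ℝ :=
  ∑ t ∈ Finset.range n, A.active t ω * (s (ω t).1 * ((ω t).2 d - μ (ω t).1.1 (ω t).1.2 d))

/-- The sum of the squared shifts of the arms pulled in the first `n` rounds before stopping. -/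
def stoppedCost (s : Arm N K → ℝ) (n : ℕ) (ω : ℕ → Step N K D) : ℝ :=
  ∑ t ∈ Finset.range n, A.active t ω * s (ω t).1 ^ 2

lemma stoppedLLR_eq (μ : MeanTensor N K D) (s : Arm N K → ℝ) (d : Fin D) (n : ℕ)
    (ω : ℕ → Step N K D) :
    A.stoppedLLR μ s d n ω = A.stoppedNoise μ s d n ω - A.stoppedCost s n ω / 2 := by
  rw [stoppedLLR, stoppedNoise, stoppedCost, Finset.sum_div, ← Finset.sum_sub_distrib]
  exact Finset.sum_congr rfl fun t _ => by rw [stepLLR]; ring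

/-- Freezing lets one threshold event at horizon `n` serve for all stopping times `m ≤ n` at once.
-/
lemma stoppedLLR_of_tau_eq (μ : MeanTensor N K D) (s : Arm N K → ℝ) (d : Fin D) {m n : ℕ}
    (hmn : m ≤ n) {ω : ℕ → Step N K D} (h : A.tau ω = m) :
    A.stoppedLLR μ s d n ω = ∑ t ∈ Finset.range m, stepLLR μ s d (ω t) := by
  have hs : Finset.range m ⊆ Finset.range n := Finset.range_subset_range.2 hmn
  rw [stoppedLLR, ← Finset.sum_subset hs]
  · refine Finset.sum_congr rfl fun t ht => ?_
    rw [A.active_of_lt, one_mul]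
    rw [h]
    exact_mod_cast Finset.mem_range.1 ht
  · intro t _ ht
    rw [A.active_of_not_lt, zero_mul]
    rw [h]
    exact_mod_cast fun hc => ht (Finset.mem_range.2 hc)

lemma measurable_shift_comp (s : Arm N K → ℝ) (t : ℕ) :
    Measurable fun ω : ℕ → Step N K D => s (ω t).1 :=
  (measurable_of_countable s).comp (measurable_fst.comp (measurable_pi_apply t))

lemma measurable_stepNoise (μ : MeanTensor N K D) (s : Arm N K → ℝ) (d : Fin D) :
    Measurable fun p : Step N K D => s p.1 * (p.2 d - μ p.1.1 p.1.2 d) := by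
  have h1 : Measurable s := measurable_of_countable _
  have h2 : Measurable fun a : Arm N K => μ a.1 a.2 d := measurable_of_countable _
  exact (h1.comp measurable_fst).mul (((measurable_pi_apply d).comp measurable_snd).sub
    (h2.comp measurable_fst))

lemma measurable_stoppedNoise (μ : MeanTensor N K D) (s : Arm N K → ℝ) (d : Fin D) (n : ℕ) :
    Measurable (A.stoppedNoise μ s d n) :=
  Finset.measurable_sum _ fun t _ =>
    (A.measurable_active t).mul ((measurable_stepNoise μ s d).comp (measurable_pi_apply t))

lemma measurable_stoppedCost (s : Arm N K → ℝ) (n : ℕ) : Measurable (A.stoppedCost s n) :=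
  Finset.measurable_sum _ fun t _ =>
    (A.measurable_active t).mul ((measurable_shift_comp s t).pow_const 2)

lemma measurable_stoppedLLR (μ : MeanTensor N K D) (s : Arm N K → ℝ) (d : Fin D) (n : ℕ) :
    Measurable (A.stoppedLLR μ s d n) :=
  Finset.measurable_sum _ fun t _ =>
    (A.measurable_active t).mul ((measurable_stepLLR μ s d).comp (measurable_pi_apply t))

lemma stoppedCost_nonneg (s : Arm N K → ℝ) (n : ℕ) (ω : ℕ → Step N K D) :
    0 ≤ A.stoppedCost s n ω :=
  Finset.sum_nonneg fun t _ => mul_nonneg (A.active_nonneg t ω) (sq_nonneg _)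

lemma dependsOnPrefix_stoppedNoise (μ : MeanTensor N K D) (s : Arm N K → ℝ) (d : Fin D) (n : ℕ) :
    DependsOnPrefix n (A.stoppedNoise μ s d n) := by
  refine fun ω ω' h => Finset.sum_congr rfl fun t ht => ?_
  have ht' := Finset.mem_range.1 ht
  rw [(A.dependsOnPrefix_active t).mono ht'.le ω ω' h, h t ht']

/-- Orthogonality of martingale increments: given the past and the arm, the new term is centered
with variance `(active * s) ^ 2`. Working with lower integrals of nonnegative functions avoids
integrability conditions. -/
lemma lintegral_sq_stoppedNoise (μ : MeanTensor N K D) (s : Arm N K → ℝ) (d : Fin D) (n : ℕ) :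
    ∫⁻ ω, ENNReal.ofReal (A.stoppedNoise μ s d n ω ^ 2) ∂(A.trajectoryLaw (gaussianEnv μ))
      = ∫⁻ ω, ENNReal.ofReal (A.stoppedCost s n ω) ∂(A.trajectoryLaw (gaussianEnv μ)) := by
  induction n with
  | zero => simp [stoppedNoise, stoppedCost]
  | succ n ih =>
    have hs : Measurable fun p : Step N K D => s p.1 :=
      (measurable_of_countable s).comp measurable_fst
    have hM := A.measurable_stoppedNoise μ s d n
    have ha := A.measurable_active n
    have hdM := A.dependsOnPrefix_stoppedNoise μ s d n
    have hda := A.dependsOnPrefix_active n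
    let Φ : (ℕ → Step N K D) → Step N K D → ℝ≥0∞ := fun ω p => ENNReal.ofReal
      ((A.stoppedNoise μ s d n ω + A.active n ω * (s p.1 * (p.2 d - μ p.1.1 p.1.2 d))) ^ 2)
    let Ψ : (ℕ → Step N K D) → Step N K D → ℝ≥0∞ := fun ω p => ENNReal.ofReal
      (A.stoppedNoise μ s d n ω ^ 2 + (A.active n ω * s p.1) ^ 2)
    have hΦ : Measurable (Function.uncurry Φ) :=
      (((hM.comp measurable_fst).add ((ha.comp measurable_fst).mul
        ((measurable_stepNoise μ s d).comp measurable_snd))).pow_const 2).ennreal_ofReal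
    have hΨ : Measurable (Function.uncurry Ψ) :=
      (((hM.comp measurable_fst).pow_const 2).add (((ha.comp measurable_fst).mul
        (hs.comp measurable_snd)).pow_const 2)).ennreal_ofReal
    have hdΦ : DependsOnPrefix n Φ := fun ω ω' h => by simp only [Φ, hdM ω ω' h, hda ω ω' h]
    have hdΨ : DependsOnPrefix n Ψ := fun ω ω' h => by simp only [Ψ, hdM ω ω' h, hda ω ω' h]
    have key := A.lintegral_next_congr (gaussianEnv μ) n hΦ hdΦ hΨ hdΨ fun ω a => by
      have h := lintegral_law_sq μ d a (A.stoppedNoise μ s d n ω) (A.active n ω * s a)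
      simp only [Φ, Ψ, lintegral_const, measure_univ, mul_one]
      simpa only [mul_assoc] using h
    have hl : ∀ ω, ENNReal.ofReal (A.stoppedNoise μ s d (n + 1) ω ^ 2) = Φ ω (ω n) := fun ω => by
      simp only [Φ, stoppedNoise, Finset.sum_range_succ]
    have hr : ∀ ω, ENNReal.ofReal (A.stoppedCost s (n + 1) ω)
        = ENNReal.ofReal (A.stoppedCost s n ω)
          + ENNReal.ofReal ((A.active n ω * s (ω n).1) ^ 2) := fun ω => by
      rw [← ENNReal.ofReal_add (A.stoppedCost_nonneg s n ω) (sq_nonneg _), stoppedCost,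
        Finset.sum_range_succ, mul_pow, active_sq]
      rfl
    have hΨ' : ∀ ω, Ψ ω (ω n) = ENNReal.ofReal (A.stoppedNoise μ s d n ω ^ 2)
          + ENNReal.ofReal ((A.active n ω * s (ω n).1) ^ 2) := fun ω =>
      ENNReal.ofReal_add (sq_nonneg _) (sq_nonneg _)
    rw [lintegral_congr hl, key, lintegral_congr hr, lintegral_congr hΨ',
      lintegral_add_left (hM.pow_const 2).ennreal_ofReal,
      lintegral_add_left (A.measurable_stoppedCost s n).ennreal_ofReal, ih]

/-- Transport of the event that the algorithm stops within `n` rounds and recommends `b`. -/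
lemma measure_stopAt_inter_le (μ : MeanTensor N K D) (s : Arm N K → ℝ) (d : Fin D) (b : Fin N)
    (n : ℕ) (x : ℝ) :
    A.trajectoryLaw (gaussianEnv μ)
        ((⋃ m ∈ Finset.range (n + 1), A.stopAt b m) ∩ {ω | -x ≤ A.stoppedLLR μ s d n ω})
      ≤ ENNReal.ofReal (Real.exp x) * A.trajectoryLaw (gaussianEnv (shiftMean μ s))
          (⋃ m, A.stopAt b m) := by
  set P := A.trajectoryLaw (gaussianEnv μ)
  set Q := A.trajectoryLaw (gaussianEnv (shiftMean μ s))
  have hE : MeasurableSet {ω | -x ≤ A.stoppedLLR μ s d n ω} :=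
    measurableSet_le measurable_const (A.measurable_stoppedLLR μ s d n)
  -- On `stopAt b m` the measure is changed at horizon `m`, where the density is the exponential of
  -- the frozen ratio, hence at least `exp (-x)`.
  have hone : ∀ m ∈ Finset.range (n + 1),
      P (A.stopAt b m ∩ {ω | -x ≤ A.stoppedLLR μ s d n ω})
        ≤ ENNReal.ofReal (Real.exp x) * Q (A.stopAt b m) := by
    intro m hm
    have hmn : m ≤ n := Nat.lt_succ_iff.1 (Finset.mem_range.1 hm)
    have hG := A.measurableSet_stopAt b m
    have hQ := lintegral_trajectoryLaw_shiftMean A μ s d m (measurable_one.indicator hG)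
      (A.dependsOnPrefix_stopAt b m).indicator_one
    rw [lintegral_indicator_one hG] at hQ
    have hm1 : Measurable ((A.stopAt b m).indicator (1 : (ℕ → Step N K D) → ℝ≥0∞)) :=
      measurable_one.indicator hG
    have hm2 : Measurable fun ω : ℕ → Step N K D =>
        ENNReal.ofReal (Real.exp (∑ t ∈ Finset.range m, stepLLR μ s d (ω t))) :=
      (Real.measurable_exp.comp (Finset.measurable_sum _ fun t _ =>
        (measurable_stepLLR μ s d).comp (measurable_pi_apply t))).ennreal_ofReal
    rw [show Q (A.stopAt b m) = _ from hQ, ← lintegral_const_mul (ENNReal.ofReal (Real.exp x))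
        (f := fun ω => (A.stopAt b m).indicator 1 ω * _) (hm1.mul hm2),
      ← lintegral_indicator_one (hG.inter hE)]
    refine lintegral_mono fun ω => ?_
    by_cases hω : ω ∈ A.stopAt b m ∩ {ω | -x ≤ A.stoppedLLR μ s d n ω}
    · rw [Set.indicator_of_mem hω]
      simp only [Pi.one_apply, Set.indicator_of_mem hω.1, one_mul]
      rw [← ENNReal.ofReal_mul (Real.exp_pos _).le, ← Real.exp_add, ENNReal.one_le_ofReal,
        Real.one_le_exp_iff, ← A.stoppedLLR_of_tau_eq μ s d hmn hω.1.1]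
      have : -x ≤ A.stoppedLLR μ s d n ω := hω.2
      linarith
    · rw [Set.indicator_of_notMem hω]
      exact zero_le
  have hdisj := A.pairwise_disjoint_stopAt b
  calc P ((⋃ m ∈ Finset.range (n + 1), A.stopAt b m) ∩ {ω | -x ≤ A.stoppedLLR μ s d n ω})
      ≤ ∑ m ∈ Finset.range (n + 1), P (A.stopAt b m ∩ {ω | -x ≤ A.stoppedLLR μ s d n ω}) := by
        rw [Set.iUnion₂_inter]
        exact measure_biUnion_finset_le _ _
    _ ≤ ∑ m ∈ Finset.range (n + 1), ENNReal.ofReal (Real.exp x) * Q (A.stopAt b m) :=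
        Finset.sum_le_sum hone
    _ = ENNReal.ofReal (Real.exp x) * ∑ m ∈ Finset.range (n + 1), Q (A.stopAt b m) := by
        rw [Finset.mul_sum]
    _ ≤ ENNReal.ofReal (Real.exp x) * Q (⋃ m, A.stopAt b m) := by
        gcongr
        rw [measure_iUnion hdisj fun m => A.measurableSet_stopAt b m]
        exact ENNReal.sum_le_tsum _

lemma measure_stoppedLLR_lt_le (μ : MeanTensor N K D) (s : Arm N K → ℝ) (d : Fin D) (n : ℕ)
    {x B : ℝ} (hx : 0 < x) (hB : 0 ≤ B)
    (hC : ∫⁻ ω, ENNReal.ofReal (A.stoppedCost s n ω) ∂(A.trajectoryLaw (gaussianEnv μ))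
      ≤ ENNReal.ofReal B) :
    A.trajectoryLaw (gaussianEnv μ) {ω | A.stoppedLLR μ s d n ω < -x}
      ≤ ENNReal.ofReal (B / x + 4 * B / x ^ 2) := by
  set P := A.trajectoryLaw (gaussianEnv μ)
  have hsub : {ω | A.stoppedLLR μ s d n ω < -x}
      ⊆ {ω | ENNReal.ofReal x ≤ ENNReal.ofReal (A.stoppedCost s n ω)}
        ∪ {ω | ENNReal.ofReal (x ^ 2 / 4) ≤ ENNReal.ofReal (A.stoppedNoise μ s d n ω ^ 2)} := by
    intro ω hω
    have hω' : A.stoppedLLR μ s d n ω < -x := hω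
    rw [stoppedLLR_eq] at hω'
    -- If the cost is below `x`, its half can account for at most `x / 2` of the deviation, so the
    -- noise lies below `-x / 2`.
    by_cases h : x ≤ A.stoppedCost s n ω
    · exact Or.inl (ENNReal.ofReal_le_ofReal h)
    · refine Or.inr (ENNReal.ofReal_le_ofReal ?_)
      nlinarith
  have h1 := meas_ge_le_lintegral_div (μ := P)
    (f := fun ω => ENNReal.ofReal (A.stoppedCost s n ω))
    (A.measurable_stoppedCost s n).ennreal_ofReal.aemeasurable
    (ENNReal.ofReal_pos.2 hx).ne' ENNReal.ofReal_ne_top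
  have h2 := meas_ge_le_lintegral_div (μ := P)
    (f := fun ω => ENNReal.ofReal (A.stoppedNoise μ s d n ω ^ 2))
    ((A.measurable_stoppedNoise μ s d n).pow_const 2).ennreal_ofReal.aemeasurable
    (ENNReal.ofReal_pos.2 (by positivity : 0 < x ^ 2 / 4)).ne' ENNReal.ofReal_ne_top
  rw [lintegral_sq_stoppedNoise] at h2
  calc P {ω | A.stoppedLLR μ s d n ω < -x}
      ≤ _ := (measure_mono hsub).trans (measure_union_le _ _)
    _ ≤ ENNReal.ofReal B / ENNReal.ofReal x + ENNReal.ofReal B / ENNReal.ofReal (x ^ 2 / 4) :=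
        add_le_add (h1.trans (by gcongr)) (h2.trans (by gcongr))
    _ = ENNReal.ofReal (B / x + 4 * B / x ^ 2) := by
        rw [← ENNReal.ofReal_div_of_pos hx, ← ENNReal.ofReal_div_of_pos (by positivity),
          ← ENNReal.ofReal_add (by positivity) (by positivity)]
        congr 2
        field_simp

end Algorithm

/-! ### The information-theoretic lower bound -/

/-- Here `5 / 12 = 1 / 2.4` is the value of `δ` beyond which the logarithm is not positive. Below
it, `y ^ 2 > 7 / 5` keeps `1 - δ - y * δ = δ * y * (y - 1)` above `1 / 12`. -/
lemma log_le_of_transport {δ B : ℝ} (hδ : 0 < δ) (hδ' : δ < 5 / 12)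
    (h : 1 - δ ≤ Real.exp (Real.log ((1 - δ) / δ) / 2) * δ + B / (Real.log ((1 - δ) / δ) / 2)
      + 4 * B / (Real.log ((1 - δ) / δ) / 2) ^ 2) :
    1 / 672 * Real.log (1 / (2.4 * δ)) ≤ B := by
  set x := Real.log ((1 - δ) / δ) / 2 with hx
  set y := Real.exp x with hy
  have hq : 0 < (1 - δ) / δ := div_pos (by linarith) hδ
  have hy0 : 0 < y := Real.exp_pos x
  have hy2 : y ^ 2 = (1 - δ) / δ := by
    rw [hy, ← Real.exp_nat_mul, hx, Nat.cast_two, mul_div_cancel₀ _ two_ne_zero, Real.exp_log hq]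
  have hyδ : y ^ 2 * δ = 1 - δ := by rw [hy2]; field_simp
  have hy14 : 7 / 5 < y ^ 2 := by
    rw [hy2, lt_div_iff₀ hδ]; linarith
  have hy118 : 1.18 < y := by nlinarith
  have hx15 : 0.15 < x := by
    have h1 : Real.log y = x := Real.log_exp x
    have h2 := Real.one_sub_inv_le_log_of_pos hy0
    have h3 : y⁻¹ < 0.85 := by
      rw [inv_lt_comm₀ hy0 (by norm_num)]
      refine lt_of_le_of_lt ?_ hy118
      norm_num
    linarith
  have hgap : 1 / 12 ≤ 1 - δ - y * δ := by
    nlinarith [mul_pos hδ (sub_pos.2 hy118), mul_pos (mul_pos hδ (sub_pos.2 hy118)) hy0]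
  have hx0 : 0 < x := by linarith
  have hBx : x ^ 2 / 12 ≤ B * (x + 4) := by
    have h1 : 1 / 12 ≤ B / x + 4 * B / x ^ 2 := by linarith
    have h2 : B / x + 4 * B / x ^ 2 = B * (x + 4) / x ^ 2 := by field_simp
    rw [h2, le_div_iff₀ (by positivity)] at h1
    linarith
  -- `336 = 12 * 28`: since `x > 0.15 > 4 / 27`, one has `x + 4 ≤ 28 * x`.
  have hB : x / 336 ≤ B := by
    by_contra hc
    push Not at hc
    nlinarith
  have hL : Real.log (1 / (2.4 * δ)) ≤ 2 * x := by
    rw [hx, mul_div_cancel₀ _ two_ne_zero]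
    refine Real.log_le_log (by positivity) ?_
    rw [div_le_div_iff₀ (by positivity) hδ]
    nlinarith
  linarith

namespace Algorithm

variable (A : Algorithm N K D)

lemma measurable_pulls (a : Arm N K) : Measurable (A.pulls a) := by
  classical
  unfold pulls
  refine Measurable.tsum fun t => Measurable.ite ?_ measurable_const measurable_const
  exact (A.measurableSet_running t).inter
    ((measurable_fst.comp (measurable_pi_apply t)) (measurableSet_singleton a))

/-- The tolerance `ε` is charged once per round up to the horizon, not per pull, so no bound on the
pulls of arms with `r a = 0` is needed. -/
lemma ofReal_stoppedCost_le {s r : Arm N K → ℝ} {ε : ℝ} (hε : 0 ≤ ε) (hr : ∀ a, 0 ≤ r a)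
    (hs : ∀ a, s a ^ 2 ≤ r a + ε) (n : ℕ) (ω : ℕ → Step N K D) :
    ENNReal.ofReal (A.stoppedCost s n ω)
      ≤ ∑ a, ENNReal.ofReal (r a) * A.pulls a ω + ENNReal.ofReal (n * ε) := by
  classical
  have hterm : ∀ t, ENNReal.ofReal (A.active t ω * r (ω t).1)
      = ∑ a, ENNReal.ofReal (r a) * if (t : ℕ∞) < A.tau ω ∧ (ω t).1 = a then 1 else 0 := by
    intro t
    by_cases ht : (t : ℕ∞) < A.tau ω
    · simp [ht, A.active_of_lt ht]
    · simp [ht, A.active_of_not_lt ht]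
  have h1 : A.stoppedCost s n ω
      ≤ ∑ t ∈ Finset.range n, A.active t ω * r (ω t).1 + n * ε := by
    have : ∑ t ∈ Finset.range n, A.active t ω * r (ω t).1 + n * ε
        = ∑ t ∈ Finset.range n, (A.active t ω * r (ω t).1 + ε) := by
      rw [Finset.sum_add_distrib]; simp
    rw [this]
    refine Finset.sum_le_sum fun t _ => ?_
    have h0 := A.active_nonneg t ω
    have h1 := A.active_le_one t ω
    nlinarith [hs (ω t).1]
  have hnn : ∀ t ∈ Finset.range n, 0 ≤ A.active t ω * r (ω t).1 := fun t _ =>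
    mul_nonneg (A.active_nonneg t ω) (hr _)
  refine (ENNReal.ofReal_le_ofReal h1).trans ?_
  rw [ENNReal.ofReal_add (Finset.sum_nonneg hnn) (by positivity),
    ENNReal.ofReal_sum_of_nonneg hnn]
  gcongr
  simp only [hterm]
  rw [Finset.sum_comm]
  refine Finset.sum_le_sum fun a _ => ?_
  rw [← Finset.mul_sum]
  gcongr
  have hp : A.pulls a ω = ∑' t : ℕ, if (t : ℕ∞) < A.tau ω ∧ (ω t).1 = a then 1 else 0 := by
    unfold pulls
    congr!
  rw [hp]
  exact ENNReal.sum_le_tsum _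

lemma lintegral_stoppedCost_le (V : Environment N K D) {s r : Arm N K → ℝ} {ε : ℝ} (hε : 0 ≤ ε)
    (hr : ∀ a, 0 ≤ r a) (hs : ∀ a, s a ^ 2 ≤ r a + ε) (n : ℕ) :
    ∫⁻ ω, ENNReal.ofReal (A.stoppedCost s n ω) ∂(A.trajectoryLaw V)
      ≤ ∑ a, ENNReal.ofReal (r a) * A.expectedPulls V a + ENNReal.ofReal (n * ε) := by
  refine (lintegral_mono fun ω => A.ofReal_stoppedCost_le hε hr hs n ω).trans ?_
  rw [lintegral_add_right _ measurable_const,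
    lintegral_finsetSum _ fun a _ => (A.measurable_pulls a).const_mul _]
  simp only [lintegral_const_mul _ (A.measurable_pulls _), lintegral_const, measure_univ, mul_one]
  rfl

/-- If the algorithm recommends `b` with probability at least `1 - δ` under the means `μ`, and
with probability at most `δ` under shifts of `μ` whose squares are arbitrarily close to `r`, then
the expected number of pulls, weighted by `r`, is of order at least `log (1 / δ)`. -/
lemma log_le_sum_expectedPulls (μ : MeanTensor N K D) (d : Fin D) (b : Fin N) {δ : ℝ}
    (hδ : 0 < δ) {r : Arm N K → ℝ} (hr : ∀ a, 0 ≤ r a)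
    (hP : ENNReal.ofReal (1 - δ) ≤ A.trajectoryLaw (gaussianEnv μ) (⋃ m, A.stopAt b m))
    (hQ : ∀ ε > 0, ∃ s : Arm N K → ℝ, (∀ a, s a ^ 2 ≤ r a + ε) ∧
      A.trajectoryLaw (gaussianEnv (shiftMean μ s)) (⋃ m, A.stopAt b m) ≤ ENNReal.ofReal δ) :
    ENNReal.ofReal (1 / 672 * Real.log (1 / (2.4 * δ)))
      ≤ ∑ a, ENNReal.ofReal (r a) * A.expectedPulls (gaussianEnv μ) a := by
  set S := ∑ a, ENNReal.ofReal (r a) * A.expectedPulls (gaussianEnv μ) a with hS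
  by_cases hδ' : 5 / 12 ≤ δ
  · have : Real.log (1 / (2.4 * δ)) ≤ 0 := by
      refine Real.log_nonpos (by positivity) ?_
      rw [div_le_one (by positivity)]
      linarith
    rw [ENNReal.ofReal_of_nonpos (by linarith)]
    exact zero_le
  push Not at hδ'
  by_cases hST : S = ⊤
  · rw [hST]; exact le_top
  obtain ⟨B, hB0, hSB⟩ : ∃ B : ℝ, 0 ≤ B ∧ S = ENNReal.ofReal B :=
    ⟨S.toReal, ENNReal.toReal_nonneg, (ENNReal.ofReal_toReal hST).symm⟩
  rw [hSB]
  refine ENNReal.ofReal_le_ofReal (log_le_of_transport hδ hδ' ?_)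
  set x := Real.log ((1 - δ) / δ) / 2 with hx
  have hx0 : 0 < x := by
    refine half_pos (Real.log_pos ?_)
    rw [lt_div_iff₀ hδ]; linarith
  set P := A.trajectoryLaw (gaussianEnv μ) with hPdef
  have key : ∀ η > 0, 1 - δ - η
      ≤ Real.exp x * δ + ((B + η) / x + 4 * (B + η) / x ^ 2) := by
    intro η hη
    have hlim : Filter.Tendsto (fun n => P (⋃ m ∈ Finset.range (n + 1), A.stopAt b m))
        Filter.atTop (nhds (P (⋃ m, A.stopAt b m))) := by
      have hdisj := A.pairwise_disjoint_stopAt b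
      rw [measure_iUnion hdisj fun m => A.measurableSet_stopAt b m]
      have := (ENNReal.tendsto_nat_tsum fun m => P (A.stopAt b m)).comp
        (Filter.tendsto_add_atTop_nat 1)
      refine this.congr fun n => ?_
      exact (measure_biUnion_finset (fun i _ j _ hij => hdisj hij)
        fun m _ => A.measurableSet_stopAt b m).symm
    have hlt : ENNReal.ofReal (1 - δ - η) < P (⋃ m, A.stopAt b m) :=
      lt_of_lt_of_le ((ENNReal.ofReal_lt_ofReal_iff (by linarith)).2 (by linarith)) hP
    obtain ⟨n, hn⟩ := (hlim.eventually (lt_mem_nhds hlt)).exists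
    -- The shift is chosen after the horizon `n`, so the total tolerance `n * ε` stays below `η`.
    obtain ⟨s, hs, hsQ⟩ := hQ (η / (n + 1)) (by positivity)
    have hnη : (n : ℝ) * (η / (n + 1)) ≤ η := by
      rw [mul_div_assoc', div_le_iff₀ (by positivity)]
      nlinarith
    have hC := A.lintegral_stoppedCost_le (gaussianEnv μ) (by positivity) hr hs n
    rw [← hS, hSB, ← ENNReal.ofReal_add hB0 (by positivity)] at hC
    have hC' := hC.trans (ENNReal.ofReal_le_ofReal (by linarith : B + n * (η / (n + 1)) ≤ B + η))
    have h1 := A.measure_stopAt_inter_le μ s d b n x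
    have h2 := A.measure_stoppedLLR_lt_le μ s d n hx0 (by positivity) hC'
    have h3 : ENNReal.ofReal (1 - δ - η) ≤ ENNReal.ofReal (Real.exp x * δ)
        + ENNReal.ofReal ((B + η) / x + 4 * (B + η) / x ^ 2) := by
      refine hn.le.trans ((measure_le_inter_add_sdiff P _
        {ω | -x ≤ A.stoppedLLR μ s d n ω}).trans (add_le_add ?_ ?_))
      · rw [ENNReal.ofReal_mul (Real.exp_pos _).le]
        exact h1.trans (by gcongr)
      · refine (measure_mono fun ω hω => ?_).trans h2
        have hω' : ¬ -x ≤ A.stoppedLLR μ s d n ω := hω.2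
        exact not_le.1 hω'
    rw [← ENNReal.ofReal_add (by positivity) (by positivity)] at h3
    exact (ENNReal.ofReal_le_ofReal_iff (by positivity)).1 h3
  have hlim : Filter.Tendsto
      (fun η : ℝ => Real.exp x * δ + ((B + η) / x + 4 * (B + η) / x ^ 2) + η)
      (nhdsWithin 0 (Set.Ioi 0))
      (nhds (Real.exp x * δ + ((B + 0) / x + 4 * (B + 0) / x ^ 2) + 0)) := by
    refine Filter.Tendsto.mono_left (Continuous.tendsto ?_ 0) nhdsWithin_le_nhds
    fun_prop
  have := ge_of_tendsto hlim (b := 1 - δ) (by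
    filter_upwards [self_mem_nhdsWithin] with η hη
    linarith [key η hη])
  simp only [add_zero] at this
  linarith

lemma le_measure_stopAt {w : Fin D → ℝ} {δ : ℝ} (hδ : 0 ≤ δ) (hA : A.IsDeltaCorrect w δ)
    {V : Environment N K D} {b : Fin N} (hb : IsUniqueBest w V.mean b)
    (hV : A.StopsAlmostSurely V) :
    ENNReal.ofReal (1 - δ) ≤ A.trajectoryLaw V (⋃ m, A.stopAt b m) := by
  rw [ENNReal.ofReal_sub _ hδ, ENNReal.ofReal_one, tsub_le_iff_right, iUnion_stopAt]
  have h := hA V b hb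
  simp only [add_zero] at h
  refine le_trans ?_ (add_le_add_right h _)
  rw [← measure_univ (μ := A.trajectoryLaw V)]
  refine (measure_mono_ae ?_).trans (measure_union_le _ _)
  filter_upwards [hV] with ω hω _
  by_cases ho : A.output ω = b
  · exact Or.inl ⟨hω, ho⟩
  · exact Or.inr ⟨hω, hb _ ho⟩

lemma measure_stopAt_le {w : Fin D → ℝ} {δ : ℝ} (hA : A.IsDeltaCorrect w δ)
    {V : Environment N K D} {b i : Fin N} (hi : IsUniqueBest w V.mean i) (hbi : b ≠ i) :
    A.trajectoryLaw V (⋃ m, A.stopAt b m) ≤ ENNReal.ofReal δ := by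
  have h := hA V i hi
  simp only [add_zero] at h
  refine (measure_mono ?_).trans h
  rw [iUnion_stopAt]
  rintro ω ⟨hω, ho⟩
  refine ⟨hω, ?_⟩
  rw [ho]
  exact hi b hbi

end Algorithm

/-! ### Gaps and shifted tensors -/

lemma weighted_add_const (w v : Fin D → ℝ) (t : ℝ) :
    weighted w (fun d => v d + t) = weighted w v + t * ∑ d, w d := by
  simp only [weighted, add_mul, Finset.sum_add_distrib, Finset.mul_sum]

lemma weighted_mono {w : Fin D → ℝ} (hw : ∀ d, 0 ≤ w d) {u v : Fin D → ℝ} (h : ∀ d, u d ≤ v d) :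
    weighted w u ≤ weighted w v :=
  Finset.sum_le_sum fun d _ => mul_le_mul_of_nonneg_right (h d) (hw d)

lemma sum_weights_pos {w : Fin D → ℝ} (hw : ∀ d, 0 ≤ w d) (hw0 : w ≠ 0) : 0 < ∑ d, w d := by
  obtain ⟨d, hd⟩ := Function.ne_iff.1 hw0
  exact Finset.sum_pos' (fun d _ => hw d) ⟨d, Finset.mem_univ d, lt_of_le_of_ne (hw d) (Ne.symm hd)⟩

lemma value_congr (w : Fin D → ℝ) {μ ν : MeanTensor N K D} {i : Fin N} (h : μ i = ν i) :
    value w μ i = value w ν i := by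
  have he : efficiency μ i = efficiency ν i := by
    funext d
    simp only [efficiency, h]
  rw [value, value, he]

lemma value_of_group_shift [NeZero K] (w : Fin D → ℝ) {μ ν : MeanTensor N K D} {i : Fin N} {t : ℝ}
    (h : ∀ j d, ν i j d = μ i j d + t) : value w ν i = value w μ i + t * ∑ d, w d := by
  rw [value, value, ← weighted_add_const]
  congr 1
  funext d
  simp only [efficiency, h]
  exact (ciSup_add (Set.finite_range _).bddAbove t).symm

/-- The real infimum of an empty set is 0, so nonemptiness has to be shown: for large `α` the raised
arm alone already beats `b`. -/
lemma exists_armShift_lt {w : Fin D → ℝ} (hw : ∀ d, 0 ≤ w d) (hw0 : w ≠ 0) (μ : MeanTensor N K D)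
    (b i : Fin N) (j : Fin K) {x : ℝ} (hx : armShift w μ b i j < x) :
    ∃ α, 0 < α ∧ α < x ∧ value w μ b < value w (raise μ i j α) i := by
  have hS := sum_weights_pos hw hw0
  have hne : {α : ℝ | 0 < α ∧ value w μ b < value w (raise μ i j α) i}.Nonempty := by
    set S := ∑ d, w d
    refine ⟨|value w μ b - weighted w (μ i j)| / S + 1, by positivity, ?_⟩
    set α := |value w μ b - weighted w (μ i j)| / S + 1
    have h1 : weighted w (fun d => μ i j d + α) ≤ value w (raise μ i j α) i := by
      refine weighted_mono hw fun d => ?_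
      refine le_trans (le_of_eq ?_) (le_ciSup (Set.finite_range _).bddAbove j)
      simp [raise]
    refine lt_of_lt_of_le ?_ h1
    rw [weighted_add_const]
    have h2 : α * S = |value w μ b - weighted w (μ i j)| + S := by
      simp only [α]; field_simp
    change _ < _ + α * S
    rw [h2]
    linarith [le_abs_self (value w μ b - weighted w (μ i j))]
  obtain ⟨α, ⟨h0, h1⟩, h2⟩ := exists_lt_of_csInf_lt hne hx
  exact ⟨α, h0, h2, h1⟩

lemma exists_subGap_lt {w : Fin D → ℝ} (hw : ∀ d, 0 ≤ w d) (hw0 : w ≠ 0) (μ : MeanTensor N K D)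
    (b i : Fin N) {x : ℝ} (hx : subGap w μ b i < x) :
    ∃ α, 0 < α ∧ α < x ∧ value w μ b < value w μ i + α * ∑ d, w d := by
  have hS := sum_weights_pos hw hw0
  have hne : {α : ℝ | 0 < α ∧ value w μ b < weighted w (fun d => efficiency μ i d + α)}.Nonempty := by
    refine ⟨|value w μ b - value w μ i| / (∑ d, w d) + 1, by positivity, ?_⟩
    rw [weighted_add_const, add_mul, div_mul_cancel₀ _ hS.ne']
    change _ < value w μ i + _
    linarith [le_abs_self (value w μ b - value w μ i)]
  obtain ⟨α, ⟨h0, h1⟩, h2⟩ := exists_lt_of_csInf_lt hne hx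
  rw [weighted_add_const] at h1
  exact ⟨α, h0, h2, h1⟩

lemma armGap_nonneg (w : Fin D → ℝ) (μ : MeanTensor N K D) (b i : Fin N) (j : Fin K) :
    0 ≤ armGap w μ b i j :=
  le_max_of_le_left (Real.sInf_nonneg fun _ h => h.1.le)

lemma groupGap_self_nonneg (w : Fin D → ℝ) (μ : MeanTensor N K D) (b : Fin N) :
    0 ≤ groupGap w μ b b := by
  rw [groupGap, if_pos rfl]
  exact Real.iInf_nonneg fun k => Real.sInf_nonneg fun _ h => h.1.le

/-! ### Lower bounds on the expected pulls -/

/-- The gaps are infima over strict inequalities and need not be attained. Admissible shifts are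
taken below twice the gap, which costs the factor 4. -/
lemma ofReal_div_sq_le {c L α x : ℝ} {E : ℝ≥0∞} (hc : 0 ≤ c) (hα : 0 < α) (hx : α < 2 * x)
    (h : ENNReal.ofReal (c * L) ≤ ENNReal.ofReal (α ^ 2) * E) :
    ENNReal.ofReal (c / 4 / x ^ 2 * L) ≤ E := by
  rcases le_or_gt L 0 with hL | hL
  · rw [ENNReal.ofReal_of_nonpos (mul_nonpos_of_nonneg_of_nonpos (by positivity) hL)]
    exact zero_le
  · have h1 : c / 4 / x ^ 2 * L ≤ c * L / α ^ 2 := by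
      have hx0 : 0 < x := by linarith
      rw [div_div, div_mul_eq_mul_div]
      exact div_le_div_of_nonneg_left (by positivity) (by positivity) (by nlinarith)
    refine (ENNReal.ofReal_le_ofReal h1).trans ?_
    rw [ENNReal.ofReal_div_of_pos (by positivity)]
    exact ENNReal.div_le_of_le_mul' h

lemma le_expectedPulls_of_ne {w : Fin D → ℝ} (hw : ∀ d, 0 ≤ w d) (hw0 : w ≠ 0) {δ : ℝ}
    (hδ : 0 < δ) {μ : MeanTensor N K D} {b : Fin N} (hb : IsUniqueBest w μ b)
    {A : Algorithm N K D} (hA : A.IsDeltaCorrect w δ) (hfin : A.StopsAlmostSurely (gaussianEnv μ))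
    {i : Fin N} (j : Fin K) (hi : i ≠ b) :
    ENNReal.ofReal (1 / 672 / 4 / (armGap w μ b i j) ^ 2 * Real.log (1 / (2.4 * δ)))
      ≤ A.expectedPulls (gaussianEnv μ) (i, j) := by
  obtain ⟨d, -⟩ := Function.ne_iff.1 hw0
  rcases (armGap_nonneg w μ b i j).eq_or_lt with hg | hg
  -- For a zero gap the left side vanishes, because division by zero gives zero; positivity of the
  -- gap need not be proved.
  · simp [← hg]
  obtain ⟨α, hα0, hα, hlt⟩ := exists_armShift_lt hw hw0 μ b i j (x := 2 * armGap w μ b i j)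
    (lt_of_le_of_lt (le_max_left _ _) (by unfold armGap at hg ⊢; linarith))
  refine ofReal_div_sq_le (by norm_num) hα0 hα ?_
  let s : Arm N K → ℝ := fun a => if a = (i, j) then α else 0
  have hmean : shiftMean μ s = raise μ i j α := by
    funext i' j' d'
    by_cases h : i' = i ∧ j' = j
    · simp [shiftMean, raise, s, h]
    · simp [shiftMean, raise, s, Prod.ext_iff, h]
  have hbest : IsUniqueBest w (gaussianEnv (shiftMean μ s)).mean i := by
    rw [mean_gaussianEnv, hmean]
    intro k hk
    have hkv : value w (raise μ i j α) k = value w μ k :=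
      value_congr w (by funext j' d'; simp [raise, hk])
    rw [hkv]
    refine lt_of_le_of_lt ?_ hlt
    rcases eq_or_ne k b with rfl | hkb
    · exact le_rfl
    · exact (hb k hkb).le
  have hP := A.le_measure_stopAt hδ.le hA (V := gaussianEnv μ) (b := b)
    (by rwa [mean_gaussianEnv]) hfin
  have key := A.log_le_sum_expectedPulls μ d b hδ (r := fun a => s a ^ 2)
    (fun a => sq_nonneg _) hP fun ε hε =>
      ⟨s, fun a => by linarith, A.measure_stopAt_le hA hbest hi.symm⟩
  refine key.trans (le_of_eq ?_)
  rw [Finset.sum_eq_single (i, j) (fun a _ ha => by simp [s, ha])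
    (fun h => absurd (Finset.mem_univ _) h)]
  simp [s]

lemma le_sum_expectedPulls_best [NeZero K] (hN : 2 ≤ N) {w : Fin D → ℝ} (hw : ∀ d, 0 ≤ w d)
    (hw0 : w ≠ 0) {δ : ℝ} (hδ : 0 < δ) {μ : MeanTensor N K D} {b : Fin N}
    (hb : IsUniqueBest w μ b) {A : Algorithm N K D} (hA : A.IsDeltaCorrect w δ)
    (hfin : A.StopsAlmostSurely (gaussianEnv μ)) :
    ENNReal.ofReal (1 / 672 / 4 / (groupGap w μ b b) ^ 2 * Real.log (1 / (2.4 * δ)))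
      ≤ ∑ j : Fin K, A.expectedPulls (gaussianEnv μ) (b, j) := by
  obtain ⟨d, -⟩ := Function.ne_iff.1 hw0
  have hS := sum_weights_pos hw hw0
  rcases (groupGap_self_nonneg w μ b).eq_or_lt with hg | hg
  · simp [← hg]
  have : Nontrivial (Fin N) := Fin.nontrivial_iff_two_le.2 hN
  obtain ⟨k₀, hk₀⟩ := exists_ne b
  have : Nonempty {k : Fin N // k ≠ b} := ⟨⟨k₀, hk₀⟩⟩
  obtain ⟨⟨i, hi⟩, himax⟩ := Finite.exists_max fun k : {k : Fin N // k ≠ b} => value w μ k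
  obtain ⟨k, hk⟩ : ∃ k : {k : Fin N // k ≠ b}, subGap w μ b k < 2 * groupGap w μ b b := by
    refine exists_lt_of_ciInf_lt (lt_of_le_of_lt (le_of_eq ?_) (by linarith :
      groupGap w μ b b < 2 * groupGap w μ b b))
    rw [groupGap, if_pos rfl]
  obtain ⟨α, hα0, hα, hlt⟩ := exists_subGap_lt hw hw0 μ b k hk
  -- The shift found for the group `k` also works for the runner-up `i`, whose value is at least
  -- that of `k`.
  have hlt' : value w μ b < value w μ i + α * ∑ d, w d := hlt.trans_le (by linarith [himax k])
  refine ofReal_div_sq_le (by norm_num) hα0 hα ?_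
  have hP := A.le_measure_stopAt hδ.le hA (V := gaussianEnv μ) (b := b)
    (by rwa [mean_gaussianEnv]) hfin
  have key := A.log_le_sum_expectedPulls μ d b hδ
    (r := fun a => if a.1 = b then α ^ 2 else 0)
    (fun a => by split_ifs <;> positivity) hP fun ε hε => by
      -- Lowering `b` by `α` puts it below `i`; the raise by `√ε` makes `i` strictly better than
      -- groups tied with it, and its square `ε` fits the tolerance.
      let s : Arm N K → ℝ := fun a => if a.1 = b then -α else if a.1 = i then √ε else 0
      refine ⟨s, fun a => ?_, A.measure_stopAt_le hA (i := i) ?_ hi.symm⟩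
      · dsimp only [s]
        split_ifs
        · linarith [neg_sq α]
        · rw [Real.sq_sqrt hε.le]; linarith
        · linarith [sq_nonneg (0 : ℝ)]
      · rw [mean_gaussianEnv]
        have hvi : value w (shiftMean μ s) i = value w μ i + √ε * ∑ d, w d :=
          value_of_group_shift w fun j d => by simp [shiftMean, s, hi]
        have hvb : value w (shiftMean μ s) b = value w μ b + -α * ∑ d, w d :=
          value_of_group_shift w fun j d => by simp [shiftMean, s]
        have hε' := mul_pos (Real.sqrt_pos.2 hε) hS
        intro l hl
        rw [hvi]
        rcases eq_or_ne l b with rfl | hlb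
        · rw [hvb]; linarith
        · have hvl : value w (shiftMean μ s) l = value w μ l :=
            value_congr w (by funext j d; simp [shiftMean, s, hl, hlb])
          rw [hvl]
          linarith [himax ⟨l, hlb⟩]
  refine key.trans (le_of_eq ?_)
  rw [Fintype.sum_prod_type, Finset.sum_eq_single b (fun k _ hk => by simp [hk])
    (fun h => absurd (Finset.mem_univ _) h), Finset.mul_sum]
  simp

end LBGI

end

open LBGI in
theorem theorem4 :
    ∃ c : ℝ, 0 < c ∧
      ∀ (N K D : ℕ), 2 ≤ N → 1 ≤ K →
      ∀ (w : Fin D → ℝ), (∀ d, 0 ≤ w d) → w ≠ 0 →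
      ∀ (δ : ℝ), 0 < δ → δ < 1 →
      ∀ (μ : MeanTensor N K D) (b : Fin N), IsUniqueBest w μ b →
        ∃ V : Environment N K D,
          V.mean = μ ∧ V.IsUnitGaussian ∧ V.IsFullyDependent ∧
          ∀ A : Algorithm N K D, A.IsDeltaCorrect w δ → A.StopsAlmostSurely V →
            (∀ (i : Fin N) (j : Fin K), i ≠ b →
              ENNReal.ofReal (c / (armGap w μ b i j) ^ 2 * Real.log (1 / (2.4 * δ)))
                ≤ A.expectedPulls V (i, j)) ∧
            ENNReal.ofReal (c / (groupGap w μ b b) ^ 2 * Real.log (1 / (2.4 * δ)))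
                ≤ ∑ j : Fin K, A.expectedPulls V (b, j) := by
  -- `672` comes from `log_le_of_transport`, and `4` from shifts of up to twice the gap.
  refine ⟨1 / 672 / 4, by norm_num, fun N K D hN hK w hw hw0 δ hδ _ μ b hb =>
    ⟨gaussianEnv μ, mean_gaussianEnv μ, isUnitGaussian_gaussianEnv μ,
      isFullyDependent_gaussianEnv μ, fun A hA hfin =>
        ⟨fun i j hi => le_expectedPulls_of_ne hw hw0 hδ hb hA hfin j hi, ?_⟩⟩⟩
  have : NeZero K := ⟨by omega⟩
  exact le_sum_expectedPulls_best hN hw hw0 hδ hb hA hfin
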